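/- For an infinite cardinal $\kappa$, let $\mathcal{L}_\kappa$ be the class of separable compact lines of weight $\kappa$, that is, of linearly ordered sets whose order topology is compact, separable and of weight $\kappa$ (the weight of a topological space is the least cardinality of a base of its topology). For a compact space $K$ let $C(K)$ be the Banach space of all continuous real-valued functions on $K$ with the supremum norm; two Banach spaces are isomorphic if there is a linear homeomorphism between them. 1. If $\kappa$ is a cardinal with $\kappa \le 2^{\omega} < 2^{\kappa}$ (so $\kappa$ is uncountable), then there is a family of $2^{\kappa}$ members $L$ of $\mathcal{L}_\kappa$ whose spaces $C(L)$ are pairwise nonisomorphic. 2. In particular, under the continuum hypothesis $2^{\omega}=\omega_1$, the number of isomorphism types of Banach spaces $C(L)$ with $L\in\mathcal{L}_{\omega_1}$ is $2^{\omega_1}$. -/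

import Mathlib

open Cardinal

/-- The weight of a topological space: the least cardinality of a base of its topology. -/
noncomputable def topWeight (X : Type) [TopologicalSpace X] : Cardinal.{0} :=
  sInf {c | ∃ B : Set (Set X), TopologicalSpace.IsTopologicalBasis B ∧ #B = c}

/-- The class of separable compact lines of weight `κ`: linearly ordered sets whose order topology
is compact, separable and of weight `κ`. -/
structure SepCompactLine (κ : Cardinal.{0}) where
  carrier : Type
  [linearOrder : LinearOrder carrier]
  [topology : TopologicalSpace carrier]
  [orderTopology : OrderTopology carrier]
  [compactSpace : CompactSpace carrier]
  [separableSpace : TopologicalSpace.SeparableSpace carrier]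
  weight_eq : topWeight carrier = κ

attribute [instance] SepCompactLine.linearOrder SepCompactLine.topology
  SepCompactLine.orderTopology SepCompactLine.compactSpace SepCompactLine.separableSpace

/-- The Banach spaces `C(K)` and `C(L)` of real-valued continuous functions, with the supremum
norm, are isomorphic: there is a linear homeomorphism between them (not necessarily isometric). -/
def IsoFunctionSpaces (K L : Type) [TopologicalSpace K] [CompactSpace K]
    [TopologicalSpace L] [CompactSpace L] : Prop :=
  Nonempty (C(K, ℝ) ≃L[ℝ] C(L, ℝ))

/-- The relation `C(K) ≃ C(L)` on separable compact lines of weight `κ`. -/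
def isoSetoid (κ : Cardinal.{0}) : Setoid (SepCompactLine κ) where
  r K L := IsoFunctionSpaces K.carrier L.carrier
  iseqv :=
    { refl := fun _ => ⟨ContinuousLinearEquiv.refl ℝ _⟩
      symm := fun ⟨e⟩ => ⟨e.symm⟩
      trans := fun ⟨e⟩ ⟨f⟩ => ⟨e.trans f⟩ }

/-- The isomorphism types of the Banach spaces `C(L)`, for `L` a separable compact line of
weight `κ`. -/
def IsoTypes (κ : Cardinal.{0}) : Type 1 := Quotient (isoSetoid κ)

/-! For a set `A` of reals, `LowerSet A` is a compact line, obtained from a real interval by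
splitting points of `A` and collapsing gaps. The rational cuts are dense in it, and its weight is
`#A` when `A` is infinite. There are `2 ^ κ` sets `A` of size `κ`, so it suffices that each
isomorphism class contains at most `2 ^ ℵ₀` of them (`mk_isoFunctionSpaces_le`).

An isomorphism of `C(LowerSet A, ℝ)` with a fixed `E` turns evaluation at the rational cuts into a
sequence in the dual of `E`. This sequence determines `A`, since a continuous function can jump at
`a` along the rationals only if `a ∈ A` (`subset_of_range_comp_ratCut_subset`). The dual of `E` has
at most `2 ^ ℵ₀` elements, because functionals correspond to functions of bounded variation
(`mk_dual_le`), so there are at most `2 ^ ℵ₀` such sequences.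

For the upper bound under CH, a separable line has at most `2 ^ ℵ₀` points, so its order is coded by
a subset of the plane. -/

open Filter Topology Set

/-! ### The space of lower sets of a linear order -/

/-- The order topology on the lower sets of a linear order. -/
instance LowerSet.orderTopologicalSpace {I : Type} [LinearOrder I] :
    TopologicalSpace (LowerSet I) :=
  Preorder.topology _

instance LowerSet.instOrderTopology {I : Type} [LinearOrder I] : OrderTopology (LowerSet I) :=
  ⟨rfl⟩

namespace LowerSet

variable {I : Type} [LinearOrder I]

theorem lt_of_mem_of_notMem {S T : LowerSet I} {i : I} (hT : i ∈ T) (hS : i ∉ S) : S < T :=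
  lt_of_not_ge fun h => hS (h hT)

theorem exists_mem_notMem_of_lt {S T : LowerSet I} (h : S < T) : ∃ i ∈ T, i ∉ S :=
  Set.exists_of_ssubset (LowerSet.coe_ssubset_coe.2 h)

theorem setOf_mem_eq_Ioi (i : I) : {T : LowerSet I | i ∈ T} = Ioi (LowerSet.Iio i) := by
  ext T
  refine ⟨fun h => lt_of_mem_of_notMem (i := i) h (by simp), fun h => ?_⟩
  obtain ⟨j, hj, hj'⟩ := exists_mem_notMem_of_lt h
  exact T.lower (by simpa using hj') hj

theorem setOf_notMem_eq_Iio (i : I) : {T : LowerSet I | i ∉ T} = Iio (LowerSet.Iic i) := by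
  ext T
  refine ⟨fun h => lt_of_mem_of_notMem (i := i) (by simp) h, fun h hi => ?_⟩
  obtain ⟨j, hj, hj'⟩ := exists_mem_notMem_of_lt h
  exact hj' (T.lower (by simpa using hj) hi)

theorem isClopen_setOf_mem (i : I) : IsClopen {T : LowerSet I | i ∈ T} := by
  refine ⟨⟨?_⟩, ?_⟩
  · rw [show {T : LowerSet I | i ∈ T}ᶜ = {T : LowerSet I | i ∉ T} from rfl, setOf_notMem_eq_Iio]
    exact isOpen_Iio
  · rw [setOf_mem_eq_Ioi]
    exact isOpen_Ioi

theorem tendsto_nhds_iff {α : Type*} {l : Filter α} {f : α → LowerSet I} {S : LowerSet I} :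
    Tendsto f l (𝓝 S) ↔
      (∀ i ∈ S, ∀ᶠ x in l, i ∈ f x) ∧ ∀ i ∉ S, ∀ᶠ x in l, i ∉ f x := by
  refine ⟨fun h => ⟨fun i hi => h.eventually ((isClopen_setOf_mem i).isOpen.mem_nhds hi),
    fun i hi => h.eventually ((isClopen_setOf_mem i).compl.isOpen.mem_nhds hi)⟩,
    fun h => tendsto_order.2 ⟨fun T hT => ?_, fun T hT => ?_⟩⟩
  · obtain ⟨i, hi, hi'⟩ := exists_mem_notMem_of_lt hT
    exact (h.1 i hi).mono fun x hx => lt_of_mem_of_notMem hx hi'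
  · obtain ⟨i, hi, hi'⟩ := exists_mem_notMem_of_lt hT
    exact (h.2 i hi').mono fun x hx => lt_of_mem_of_notMem hi hx

/-- The sets `{T | i ∈ T}` and their complements form a subbasis. -/
theorem eq_generateFrom : LowerSet.orderTopologicalSpace (I := I) =
    TopologicalSpace.generateFrom
      (range (fun i : I => {T : LowerSet I | i ∈ T}) ∪
        range (fun i : I => {T : LowerSet I | i ∉ T})) := by
  apply le_antisymm
  · refine le_generateFrom ?_
    rintro _ (⟨i, rfl⟩ | ⟨i, rfl⟩)
    · exact (isClopen_setOf_mem i).isOpen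
    · exact (isClopen_setOf_mem i).compl.isOpen
  · refine le_of_nhds_le_nhds fun S => ?_
    have key := (tendsto_nhds_iff (l := @nhds _ (TopologicalSpace.generateFrom
      (range (fun i : I => {T : LowerSet I | i ∈ T}) ∪
        range (fun i : I => {T : LowerSet I | i ∉ T}))) S) (f := id) (S := S)).2 ⟨?_, ?_⟩
    · exact key
    · intro i hi
      exact @IsOpen.mem_nhds _ (_) S _ (.basic _ (.inl ⟨i, rfl⟩)) hi
    · intro i hi
      exact @IsOpen.mem_nhds _ (_) S _ (.basic _ (.inr ⟨i, rfl⟩)) hi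

/-- The open set `{T | i ∉ T}` has greatest element `Iio i`, so a basic set between that point and
this open set determines `i`. -/
theorem mk_le_of_isTopologicalBasis {B : Set (Set (LowerSet I))}
    (hB : TopologicalSpace.IsTopologicalBasis B) : #I ≤ #B := by
  have h : ∀ i : I, ∃ b ∈ B, LowerSet.Iio i ∈ b ∧ b ⊆ {T | i ∉ T} := fun i =>
    hB.exists_subset_of_mem_open (by simp) (isClopen_setOf_mem i).compl.isOpen
  choose b hbB hmem hsub using h
  refine mk_le_of_injective (f := fun i => (⟨b i, hbB i⟩ : B)) fun i j hij => ?_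
  have hij : b i = b j := congrArg Subtype.val hij
  have h1 : i ∉ LowerSet.Iio j := hsub i (hij ▸ hmem j)
  have h2 : j ∉ LowerSet.Iio i := hsub j (hij ▸ hmem i)
  simp only [mem_Iio_iff, not_lt] at h1 h2
  exact le_antisymm h2 h1

theorem exists_isTopologicalBasis_mk_le [Infinite I] :
    ∃ B : Set (Set (LowerSet I)), TopologicalSpace.IsTopologicalBasis B ∧ #B ≤ #I := by
  refine ⟨_, TopologicalSpace.isTopologicalBasis_of_subbasis eq_generateFrom, ?_⟩
  let g : I ⊕ I → Set (LowerSet I) := Sum.elim (fun i => {T | i ∈ T}) fun i => {T | i ∉ T}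
  refine (mk_le_mk_of_subset (t := range fun s : Finset (I ⊕ I) => ⋂₀ (g '' s)) ?_).trans
    (mk_range_le.trans ?_)
  · rintro _ ⟨F, ⟨hfin, hF⟩, rfl⟩
    rw [← Sum.elim_range, ← image_univ] at hF
    obtain ⟨s, -, hs, hsF⟩ := (exists_subset_image_finite_and (p := fun t => t = F)).1
      ⟨F, hF, hfin, rfl⟩
    exact ⟨hs.toFinset, by simp [g, hsF]⟩
  · rw [mk_finset_of_infinite]
    simp [add_eq_self (aleph0_le_mk I)]

theorem topWeight_eq [Infinite I] : topWeight (LowerSet I) = #I := by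
  obtain ⟨B, hB, hBI⟩ := exists_isTopologicalBasis_mk_le (I := I)
  unfold topWeight
  refine le_antisymm (le_trans (csInf_le' ?_) hBI) (le_csInf ⟨#B, ?_⟩ ?_)
  · exact ⟨B, hB, rfl⟩
  · exact ⟨B, hB, rfl⟩
  rintro _ ⟨B', hB', rfl⟩
  exact mk_le_of_isTopologicalBasis hB'

end LowerSet

/-! ### Rational cuts -/

namespace LowerSet

/-- The lower set of all elements of `A ⊆ ℝ` below a rational number. -/
def ratCut (A : Set ℝ) (q : ℚ) : LowerSet A where
  carrier := {a | (a : ℝ) ≤ q}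
  lower' := fun _ _ hba ha => le_trans (Subtype.coe_le_coe.2 hba) ha

@[simp]
theorem mem_ratCut {A : Set ℝ} {q : ℚ} {a : A} : a ∈ ratCut A q ↔ (a : ℝ) ≤ q := Iff.rfl

instance neBot_comap_ratCast_nhdsLT (x : ℝ) : (comap ((↑) : ℚ → ℝ) (𝓝[<] x)).NeBot := by
  refine comap_neBot fun t ht => ?_
  obtain ⟨l, hl, hlt⟩ := (mem_nhdsLT_iff_exists_Ioo_subset).1 ht
  obtain ⟨q, hq⟩ := exists_rat_btwn (show l < x from hl)
  exact ⟨q, hlt hq⟩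

instance neBot_comap_ratCast_nhdsGT (x : ℝ) : (comap ((↑) : ℚ → ℝ) (𝓝[>] x)).NeBot := by
  refine comap_neBot fun t ht => ?_
  obtain ⟨l, hl, hlt⟩ := (mem_nhdsGT_iff_exists_Ioo_subset).1 ht
  obtain ⟨q, hq⟩ := exists_rat_btwn (show x < l from hl)
  exact ⟨q, hlt hq⟩

theorem tendsto_ratCut_nhdsLT {A : Set ℝ} {x : ℝ} {S : LowerSet A}
    (hS : ∀ a : A, a ∈ S ↔ (a : ℝ) < x) :
    Tendsto (ratCut A) (comap (↑) (𝓝[<] x)) (𝓝 S) := by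
  refine tendsto_nhds_iff.2 ⟨fun i hi => ?_, fun i hi => ?_⟩
  · have : ∀ᶠ y in 𝓝[<] x, (i : ℝ) ≤ y :=
      (eventually_ge_nhds ((hS i).1 hi)).filter_mono nhdsWithin_le_nhds
    exact (this.comap _).mono fun q hq => hq
  · rw [hS, not_lt] at hi
    exact (eventually_mem_nhdsWithin.comap _).mono fun q hq h =>
      absurd h (not_le.2 (lt_of_lt_of_le hq hi))

theorem tendsto_ratCut_nhdsGT {A : Set ℝ} {x : ℝ} {S : LowerSet A}
    (hS : ∀ a : A, a ∈ S ↔ (a : ℝ) ≤ x) :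
    Tendsto (ratCut A) (comap (↑) (𝓝[>] x)) (𝓝 S) := by
  refine tendsto_nhds_iff.2 ⟨fun i hi => ?_, fun i hi => ?_⟩
  · exact (eventually_mem_nhdsWithin.comap _).mono fun q hq => ((hS i).1 hi).trans (le_of_lt hq)
  · rw [hS, not_le] at hi
    have : ∀ᶠ y in 𝓝[>] x, y < (i : ℝ) :=
      (eventually_lt_nhds hi).filter_mono nhdsWithin_le_nhds
    exact (this.comap _).mono fun q hq => not_le.2 hq

/-- Let `x` be the supremum of a proper nonempty `S`. If `x` is attained, then `S` consists of the
elements `≤ x` and is approached from the right; otherwise of those `< x`, approached from the left.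
-/
theorem denseRange_ratCut (A : Set ℝ) : DenseRange (ratCut A) := by
  intro S
  suffices h : ∃ l : Filter ℚ, l.NeBot ∧ Tendsto (ratCut A) l (𝓝 S) by
    obtain ⟨l, hl, h⟩ := h
    exact mem_closure_of_tendsto h (Eventually.of_forall fun q => mem_range_self q)
  by_cases hbot : ∀ a, a ∉ S
  · refine ⟨atBot, inferInstance, tendsto_nhds_iff.2
      ⟨fun i hi => absurd hi (hbot i), fun i _ => ?_⟩⟩
    obtain ⟨q, hq⟩ := exists_rat_lt (i : ℝ)
    filter_upwards [eventually_le_atBot q] with r hr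
    exact not_le.2 (lt_of_le_of_lt (Rat.cast_le.2 hr) hq)
  by_cases htop : ∀ a, a ∈ S
  · refine ⟨atTop, inferInstance, tendsto_nhds_iff.2
      ⟨fun i _ => ?_, fun i hi => absurd (htop i) hi⟩⟩
    obtain ⟨q, hq⟩ := exists_rat_gt (i : ℝ)
    filter_upwards [eventually_ge_atTop q] with r hr
    exact hq.le.trans (Rat.cast_le.2 hr)
  push Not at hbot htop
  obtain ⟨a, ha⟩ := hbot
  obtain ⟨b, hb⟩ := htop
  have hlt : ∀ c ∈ S, ∀ d ∉ S, c < d := fun c hc d hd =>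
    lt_of_not_ge fun h => hd (S.lower h hc)
  have hne : ((↑) '' (S : Set A) : Set ℝ).Nonempty := ⟨a, a, ha, rfl⟩
  have hlub := isLUB_csSup hne
    ⟨b, by rintro _ ⟨c, hc, rfl⟩; exact (Subtype.coe_le_coe.2 (hlt c hc b hb).le)⟩
  set x := sSup ((↑) '' (S : Set A) : Set ℝ)
  have hnot : ∀ d ∉ S, x ≤ (d : ℝ) := fun d hd => hlub.2 <| by
    rintro _ ⟨c, hc, rfl⟩; exact (Subtype.coe_le_coe.2 (hlt c hc d hd).le)
  by_cases hx : ∃ c ∈ S, (c : ℝ) = x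
  · obtain ⟨c, hc, hcx⟩ := hx
    refine ⟨_, neBot_comap_ratCast_nhdsGT x, tendsto_ratCut_nhdsGT fun d =>
      ⟨fun hd => hlub.1 ⟨d, hd, rfl⟩, fun hd => S.lower ?_ hc⟩⟩
    exact Subtype.coe_le_coe.1 (hd.trans hcx.ge)
  · push Not at hx
    refine ⟨_, neBot_comap_ratCast_nhdsLT x, tendsto_ratCut_nhdsLT fun d =>
      ⟨fun hd => lt_of_le_of_ne (hlub.1 ⟨d, hd, rfl⟩) (hx d hd), fun hd => ?_⟩⟩
    by_contra h
    exact absurd (hnot d h) (not_le.2 hd)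

instance separableSpace (A : Set ℝ) : TopologicalSpace.SeparableSpace (LowerSet A) :=
  ⟨⟨_, countable_range _, denseRange_ratCut A⟩⟩

/-- The characteristic function of the clopen set of lower sets that contain `i`. -/
noncomputable def indicatorMap {I : Type} [LinearOrder I] (i : I) : C(LowerSet I, ℝ) where
  toFun := {T : LowerSet I | i ∈ T}.indicator 1
  continuous_toFun := (isClopen_setOf_mem i).continuous_indicator continuous_one

open Classical in
theorem indicatorMap_apply {I : Type} [LinearOrder I] (i : I) (T : LowerSet I) :
    indicatorMap i T = if i ∈ T then 1 else 0 := by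
  simp [indicatorMap, indicator_apply]

/-- The restrictions of continuous functions to the rational cuts determine the set `A`. -/
theorem subset_of_range_comp_ratCut_subset {A A' : Set ℝ}
    (h : range (fun g : C(LowerSet A, ℝ) => g ∘ ratCut A) ⊆
      range (fun g : C(LowerSet A', ℝ) => g ∘ ratCut A')) : A ⊆ A' := by
  intro a ha
  by_contra ha'
  obtain ⟨g, hg⟩ := h ⟨indicatorMap (⟨a, ha⟩ : A), rfl⟩
  have hg : ∀ q, g (ratCut A' q) = indicatorMap (⟨a, ha⟩ : A) (ratCut A q) := congrFun hg
  -- As `a ∉ A'`, the cuts `< a` and `≤ a` of `A'` coincide, so `g` has a single limit there,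
  -- whereas the indicator of `a` forces 0 from the left and 1 from the right.
  let S : LowerSet A' :=
    ⟨{c | (c : ℝ) < a}, fun _ _ hba ha => lt_of_le_of_lt (Subtype.coe_le_coe.2 hba) ha⟩
  have hS : ∀ c : A', c ∈ S ↔ (c : ℝ) < a := fun _ => Iff.rfl
  have hS' : ∀ c : A', c ∈ S ↔ (c : ℝ) ≤ a := fun c =>
    ⟨fun h => le_of_lt h, fun h => lt_of_le_of_ne h fun h => ha' (h ▸ c.2)⟩
  have h0 : g S = 0 := by
    refine tendsto_nhds_unique ((g.continuous.tendsto S).comp (tendsto_ratCut_nhdsLT hS))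
      (tendsto_const_nhds.congr' ((eventually_mem_nhdsWithin.comap _).mono fun q hq => ?_))
    simp only [Function.comp_apply, hg, indicatorMap_apply, mem_ratCut]
    rw [if_neg (not_le.2 hq)]
  have h1 : g S = 1 := by
    refine tendsto_nhds_unique ((g.continuous.tendsto S).comp (tendsto_ratCut_nhdsGT hS'))
      (tendsto_const_nhds.congr' ((eventually_mem_nhdsWithin.comap _).mono fun q hq => ?_))
    simp only [Function.comp_apply, hg, indicatorMap_apply, mem_ratCut]
    rw [if_pos (le_of_lt hq)]
  exact zero_ne_one (h0.symm.trans h1)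

end LowerSet

/-! ### Cardinality of separable lines -/

/-- A separable linearly ordered space has at most continuum many points. -/
theorem mk_le_two_power_aleph0_of_separableSpace (X : Type) [LinearOrder X] [TopologicalSpace X]
    [OrderTopology X] [TopologicalSpace.SeparableSpace X] : #X ≤ 2 ^ ℵ₀ := by
  obtain ⟨D, hD, hdense⟩ := TopologicalSpace.exists_countable_dense X
  let cut : X → Set D := fun x => {d | (d : X) < x}
  have key : ∀ x y z, x < y → y < z → cut x ≠ cut z := by
    intro x y z hxy hyz h
    obtain ⟨d, hd, hdD⟩ := hdense.inter_open_nonempty _ (isOpen_Ioo (a := x) (b := z)) ⟨y, hxy, hyz⟩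
    have : (⟨d, hdD⟩ : D) ∈ cut x := h ▸ hd.2
    exact lt_asymm hd.1 this
  -- By `key` at most two points share a cut; the second component tells whether a point is the
  -- smaller one.
  have hinj : Function.Injective fun x => (cut x, ∀ y, cut y = cut x → x ≤ y) := by
    have aux : ∀ x y, x < y → cut x = cut y →
        ((∀ z, cut z = cut x → x ≤ z) ↔ ∀ z, cut z = cut y → y ≤ z) → False := by
      intro x y hxy hc h
      by_cases hx : ∀ z, cut z = cut x → x ≤ z
      · exact absurd (h.1 hx x hc) (not_le.2 hxy)
      · push Not at hx
        obtain ⟨z, hz, hzx⟩ := hx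
        exact key z x y hzx hxy (hz.trans hc)
    intro x y hxy
    simp only [Prod.mk.injEq, eq_iff_iff] at hxy
    rcases lt_trichotomy x y with h | h | h
    · exact (aux x y h hxy.1 hxy.2).elim
    · exact h
    · exact (aux y x h hxy.1.symm hxy.2.symm).elim
  have : Countable D := hD
  calc #X ≤ #(Set D × Prop) := mk_le_of_injective hinj
    _ = 2 ^ #D * 2 := by simp
    _ ≤ 2 ^ ℵ₀ * 2 := by
      gcongr
      exact power_le_power_left two_ne_zero mk_le_aleph0
    _ = 2 ^ ℵ₀ := mul_eq_left (cantor ℵ₀).le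
      ((natCast_lt_aleph0 (n := 2)).le.trans (cantor ℵ₀).le) two_ne_zero

/-- There are at most continuum many monotone real functions on a linear order whose space of
lower sets is separable. -/
theorem mk_monotone_le (I : Type) [LinearOrder I]
    [TopologicalSpace.SeparableSpace (LowerSet I)] : #{f : I → ℝ // Monotone f} ≤ 2 ^ ℵ₀ := by
  let F : {f : I → ℝ // Monotone f} → ℚ → LowerSet I := fun f q =>
    ⟨{i | f.1 i < q}, fun _ _ hba ha => lt_of_le_of_lt (f.2 hba) ha⟩
  have hF : Function.Injective F := by
    intro f g hfg
    have h : ∀ (q : ℚ) i, f.1 i < q ↔ g.1 i < q := fun q i =>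
      SetLike.ext_iff.1 (congrFun hfg q) i
    refine Subtype.ext (funext fun i => le_antisymm ?_ ?_)
    · refine le_of_forall_rat_lt_imp_le fun q hq => le_of_not_gt fun hlt => ?_
      exact lt_asymm hq ((h q i).2 hlt)
    · refine le_of_forall_rat_lt_imp_le fun q hq => le_of_not_gt fun hlt => ?_
      exact lt_asymm hq ((h q i).1 hlt)
  calc _ ≤ #(ℚ → LowerSet I) := mk_le_of_injective hF
    _ = #(LowerSet I) ^ ℵ₀ := by simp
    _ ≤ (2 ^ ℵ₀) ^ ℵ₀ :=
      power_le_power_right (mk_le_two_power_aleph0_of_separableSpace _)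
    _ ≤ 2 ^ ℵ₀ := by simp

/-! ### Functionals on the continuous functions on the space of lower sets -/

namespace LowerSet

variable {I : Type} [LinearOrder I]

theorem indicatorMap_mul (i j : I) :
    indicatorMap i * indicatorMap j = indicatorMap (max i j) := by
  classical
  ext T
  simp only [ContinuousMap.mul_apply, indicatorMap_apply]
  rcases le_total i j with h | h
  · by_cases hj : j ∈ T
    · simp [h, hj, show i ∈ T from T.lower h hj]
    · simp [h, hj]
  · by_cases hi : i ∈ T
    · simp [h, hi, show j ∈ T from T.lower h hi]
    · simp [h, hi]

/-- A functional on `C(LowerSet I, ℝ)` is determined by its values at `1` and at the functions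
`indicatorMap i`. -/
theorem dual_ext {φ ψ : C(LowerSet I, ℝ) →L[ℝ] ℝ} (h1 : φ 1 = ψ 1)
    (h : ∀ i, φ (indicatorMap i) = ψ (indicatorMap i)) : φ = ψ := by
  -- This set is closed under products, so its linear span is already an algebra and
  -- Stone–Weierstrass makes the span dense.
  let M : Submonoid C(LowerSet I, ℝ) :=
    { carrier := insert 1 (range indicatorMap)
      one_mem' := mem_insert _ _
      mul_mem' := by
        rintro a b (rfl | ⟨i, rfl⟩) (rfl | ⟨j, rfl⟩)
        · simp
        · simp
        · simp
        · exact .inr ⟨_, (indicatorMap_mul i j).symm⟩ }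
  have hdense : (Algebra.adjoin ℝ (M : Set C(LowerSet I, ℝ))).topologicalClosure = ⊤ := by
    refine ContinuousMap.subalgebra_topologicalClosure_eq_top_of_separatesPoints _ fun S T hST => ?_
    have : ∃ i, ¬ (i ∈ S ↔ i ∈ T) := by
      by_contra! h
      exact hST (SetLike.ext h)
    obtain ⟨i, hi⟩ := this
    refine ⟨_, ⟨indicatorMap i, Algebra.subset_adjoin (.inr ⟨i, rfl⟩), rfl⟩, ?_⟩
    classical
    simp only [indicatorMap_apply]
    by_cases hS : i ∈ S <;> by_cases hT : i ∈ T <;> simp_all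
  have hspan : Dense (Submodule.span ℝ (M : Set C(LowerSet I, ℝ)) : Set C(LowerSet I, ℝ)) := by
    have hM : Submodule.span ℝ (M : Set C(LowerSet I, ℝ)) =
        Subalgebra.toSubmodule (Algebra.adjoin ℝ (M : Set C(LowerSet I, ℝ))) := by
      rw [Algebra.adjoin_eq_span, Submonoid.closure_eq]
    intro f
    rw [hM]
    exact (hdense ▸ Algebra.mem_top : f ∈ (Algebra.adjoin ℝ (M : Set _)).topologicalClosure)
  refine ContinuousLinearMap.ext_on hspan ?_
  rintro _ (rfl | ⟨i, rfl⟩)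
  · exact h1
  · exact h i

/-- Test `φ` on the signed sum of the differences: the indicators decrease along `u`, so the
absolute values telescope and the sum has norm at most 1. -/
theorem sum_abs_sub_le_norm (φ : C(LowerSet I, ℝ) →L[ℝ] ℝ) {u : ℕ → I} (hu : Monotone u) (n : ℕ) :
    ∑ k ∈ Finset.range n, |φ (indicatorMap (u (k + 1))) - φ (indicatorMap (u k))| ≤ ‖φ‖ := by
  classical
  have hsign : ∀ x : ℝ, ∃ ε : ℝ, |ε| ≤ 1 ∧ ε * x = |x| := fun x => by
    rcases le_total 0 x with h | h
    · exact ⟨1, by simp, by simp [abs_of_nonneg h]⟩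
    · exact ⟨-1, by simp, by simp [abs_of_nonpos h]⟩
  choose ε hε hεx using fun k => hsign (φ (indicatorMap (u (k + 1))) - φ (indicatorMap (u k)))
  let f : C(LowerSet I, ℝ) :=
    ∑ k ∈ Finset.range n, ε k • (indicatorMap (u (k + 1)) - indicatorMap (u k))
  have hf : ‖f‖ ≤ 1 := by
    refine (ContinuousMap.norm_le _ zero_le_one).2 fun T => ?_
    have hanti : ∀ k, indicatorMap (u (k + 1)) T ≤ indicatorMap (u k) T := fun k => by
      simp only [indicatorMap_apply]
      by_cases h : u (k + 1) ∈ T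
      · simp [h, show u k ∈ T from T.lower (hu (Nat.le_succ k)) h]
      · simp only [h, if_false]
        split_ifs <;> norm_num
    calc ‖f T‖ = |∑ k ∈ Finset.range n,
            ε k * (indicatorMap (u (k + 1)) T - indicatorMap (u k) T)| := by
          simp [f, ContinuousMap.sum_apply]
      _ ≤ ∑ k ∈ Finset.range n, |ε k * (indicatorMap (u (k + 1)) T - indicatorMap (u k) T)| :=
          Finset.abs_sum_le_sum_abs _ _
      _ ≤ ∑ k ∈ Finset.range n, (indicatorMap (u k) T - indicatorMap (u (k + 1)) T) := by
          refine Finset.sum_le_sum fun k _ => ?_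
          rw [abs_mul, abs_of_nonpos (sub_nonpos.2 (hanti k)), neg_sub]
          exact mul_le_of_le_one_left (sub_nonneg.2 (hanti k)) (hε k)
      _ = indicatorMap (u 0) T - indicatorMap (u n) T := Finset.sum_range_sub' _ _
      _ ≤ 1 := by
          simp only [indicatorMap_apply]
          split_ifs <;> norm_num
  calc _ = φ f := by
        simp only [f, map_sum, map_smul, map_sub, smul_eq_mul, hεx]
    _ ≤ ‖φ f‖ := le_abs_self _
    _ ≤ ‖φ‖ * ‖f‖ := φ.le_opNorm f
    _ ≤ ‖φ‖ := mul_le_of_le_one_right φ.opNorm_nonneg hf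

theorem boundedVariationOn_dual (φ : C(LowerSet I, ℝ) →L[ℝ] ℝ) :
    BoundedVariationOn (fun i => φ (indicatorMap i)) univ := by
  refine ne_top_of_le_ne_top (b := ENNReal.ofReal ‖φ‖) ENNReal.ofReal_ne_top (iSup_le fun p => ?_)
  simp only [edist_dist, Real.dist_eq]
  rw [← ENNReal.ofReal_sum_of_nonneg fun _ _ => abs_nonneg _]
  exact ENNReal.ofReal_le_ofReal (sum_abs_sub_le_norm φ p.2.2.1 p.1)

theorem exists_monotone_sub_monotone_dual (φ : C(LowerSet I, ℝ) →L[ℝ] ℝ) :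
    ∃ p : {f : I → ℝ // Monotone f} × {f : I → ℝ // Monotone f},
      ∀ i, φ (indicatorMap i) = p.1.1 i - p.2.1 i := by
  obtain ⟨p, q, hp, hq, h⟩ :=
    (boundedVariationOn_dual φ).locallyBoundedVariationOn.exists_monotoneOn_sub_monotoneOn
  exact ⟨⟨⟨p, monotoneOn_univ.1 hp⟩, q, monotoneOn_univ.1 hq⟩, congrFun h⟩

/-- If the space of lower sets is separable, then `C(LowerSet I, ℝ)` has at most continuum many
bounded functionals. -/
theorem mk_dual_le [TopologicalSpace.SeparableSpace (LowerSet I)] :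
    #(C(LowerSet I, ℝ) →L[ℝ] ℝ) ≤ 2 ^ ℵ₀ := by
  choose p hp using exists_monotone_sub_monotone_dual (I := I)
  have hinj : Function.Injective fun φ : C(LowerSet I, ℝ) →L[ℝ] ℝ => (φ 1, p φ) := by
    intro φ ψ h
    simp only [Prod.mk.injEq] at h
    exact dual_ext h.1 fun i => by rw [hp, hp, h.2]
  calc _ ≤ #(ℝ × {f : I → ℝ // Monotone f} × {f : I → ℝ // Monotone f}) := mk_le_of_injective hinj
    _ ≤ 2 ^ ℵ₀ * (2 ^ ℵ₀ * 2 ^ ℵ₀) := by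
      simp only [mk_prod, lift_id]
      gcongr
      · rw [mk_real, two_power_aleph0]
      · exact mk_monotone_le I
      · exact mk_monotone_le I
    _ = 2 ^ ℵ₀ := by simp

end LowerSet

/-! ### Counting isomorphism types -/

namespace LowerSet

/-- Among the spaces `C(LowerSet A, ℝ)` for distinct sets `A` of reals,
at most continuum many are isomorphic to a given one. -/
theorem mk_isoFunctionSpaces_le {J : Type} {A : J → Set ℝ} (hinj : Function.Injective A) (j₀ : J) :
    #{j // IsoFunctionSpaces (LowerSet (A j)) (LowerSet (A j₀))} ≤ 2 ^ ℵ₀ := by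
  let E := C(LowerSet (A j₀), ℝ)
  let e (j : {j // IsoFunctionSpaces (LowerSet (A j)) (LowerSet (A j₀))}) :
      C(LowerSet (A j), ℝ) ≃L[ℝ] E := Nonempty.some j.2
  let Φ : {j // IsoFunctionSpaces (LowerSet (A j)) (LowerSet (A j₀))} → ℚ → E →L[ℝ] ℝ :=
    fun j q => (ContinuousMap.evalCLM ℝ (ratCut (A j) q)).comp (e j).symm.toContinuousLinearMap
  have hΦ : ∀ j, range (fun (f : E) q => Φ j q f) =
      range (fun g : C(LowerSet (A j), ℝ) => g ∘ ratCut (A j)) := fun j =>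
    (e j).symm.surjective.range_comp fun g : C(LowerSet (A j), ℝ) => g ∘ ratCut (A j)
  have hΦinj : Function.Injective Φ := by
    intro i j hij
    have h := (hΦ i).symm.trans (hij ▸ hΦ j)
    exact Subtype.ext (hinj ((subset_of_range_comp_ratCut_subset h.subset).antisymm
      (subset_of_range_comp_ratCut_subset h.superset)))
  calc _ ≤ #(ℚ → E →L[ℝ] ℝ) := mk_le_of_injective hΦinj
    _ = #(E →L[ℝ] ℝ) ^ ℵ₀ := by simp
    _ ≤ (2 ^ ℵ₀) ^ ℵ₀ := power_le_power_right mk_dual_le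
    _ = 2 ^ ℵ₀ := by simp

end LowerSet

theorem aleph0_lt_of_two_power_lt {κ : Cardinal.{0}} (h : (2 : Cardinal.{0}) ^ ℵ₀ < 2 ^ κ) :
    ℵ₀ < κ :=
  lt_of_not_ge fun hκ => not_le.2 h (power_le_power_left two_ne_zero hκ)

/-- There are `2 ^ κ` sets of `κ` reals. -/
theorem exists_injective_set_real {κ : Cardinal.{0}} (hκ : κ ≤ 2 ^ ℵ₀) (h0 : ℵ₀ ≤ κ) :
    ∃ A : Set κ.out → Set ℝ, Function.Injective A ∧ ∀ Z, #(A Z) = κ := by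
  have hle : #(κ.out ⊕ κ.out) ≤ #ℝ := by
    simpa [add_eq_self h0, mk_real] using hκ
  obtain ⟨g⟩ := hle
  -- The left copy of `κ` forces cardinality `κ`; the right copy encodes `Z`.
  refine ⟨fun Z => g '' (range Sum.inl ∪ Sum.inr '' Z), fun Z Z' h => ?_,
    fun Z => le_antisymm ?_ ?_⟩
  · have h := g.injective.image_injective h
    ext k
    simpa using Set.ext_iff.1 h (.inr k)
  · refine mk_image_le.trans ((mk_set_le _).trans ?_)
    simp [add_eq_self h0]
  · calc κ = #(g '' range Sum.inl) := by
          rw [← range_comp, mk_range_eq _ (g.injective.comp Sum.inl_injective), mk_out]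
      _ ≤ _ := mk_le_mk_of_subset (image_mono subset_union_left)

theorem exists_pairwise_not_isoFunctionSpaces {κ : Cardinal.{0}} (hκ : κ ≤ 2 ^ ℵ₀)
    (h : (2 : Cardinal.{0}) ^ ℵ₀ < 2 ^ κ) :
    ∃ (ι : Type) (L : ι → SepCompactLine κ), #ι = 2 ^ κ ∧
      Pairwise fun i j => ¬ IsoFunctionSpaces (L i).carrier (L j).carrier := by
  have h0 := (aleph0_lt_of_two_power_lt h).le
  obtain ⟨A, hinj, hcard⟩ := exists_injective_set_real hκ h0
  have hinf : ∀ Z, Infinite (A Z) := fun Z => by rw [infinite_iff, hcard]; exact h0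
  let L : Set κ.out → SepCompactLine κ := fun Z =>
    { carrier := LowerSet (A Z)
      weight_eq := LowerSet.topWeight_eq.trans (hcard Z) }
  let s : Setoid (Set κ.out) := (isoSetoid κ).comap L
  refine ⟨Quotient s, fun x => L x.out, ?_, fun x y hxy hiso => hxy ?_⟩
  · have hJ : #(Set κ.out) = 2 ^ κ := by simp
    refine le_antisymm (mk_quotient_le.trans hJ.le) (le_of_not_gt fun hlt => ?_)
    have hle : #(Set κ.out) ≤ #(Quotient s) * 2 ^ ℵ₀ := by
      refine mk_le_mk_mul_of_mk_preimage_le (Quotient.mk s) fun x => ?_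
      obtain ⟨Z₀, rfl⟩ := Quotient.exists_rep x
      refine (mk_le_mk_of_subset fun Z hZ => ?_).trans
        (LowerSet.mk_isoFunctionSpaces_le hinj Z₀)
      exact Quotient.exact hZ
    rw [hJ] at hle
    exact not_le.2 (mul_lt_of_lt (h0.trans (cantor κ).le) hlt h) hle
  · rw [← x.out_eq, ← y.out_eq]
    exact Quotient.sound hiso

/-- Separable compact lines that are order isomorphic have isomorphic function spaces. -/
theorem isoFunctionSpaces_of_orderIso {κ : Cardinal.{0}} {K L : SepCompactLine κ}
    (e : K.carrier ≃o L.carrier) : IsoFunctionSpaces K.carrier L.carrier :=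
  ⟨{ toFun f := f.comp ⟨e.symm, e.symm.continuous⟩
     invFun f := f.comp ⟨e, e.continuous⟩
     map_add' _ _ := rfl
     map_smul' _ _ := rfl
     left_inv f := by ext; simp
     right_inv f := by ext; simp
     continuous_toFun := ContinuousMap.continuous_precomp _
     continuous_invFun := ContinuousMap.continuous_precomp _ }⟩

theorem mk_isoTypes_le (κ : Cardinal.{0}) :
    #(IsoTypes κ) ≤ Cardinal.lift.{1, 0} (2 ^ ((2 : Cardinal.{0}) ^ ℵ₀)) := by
  have hemb : ∀ L : SepCompactLine κ, Nonempty (L.carrier ↪ ℝ) := fun L => by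
    rw [← Cardinal.le_def, mk_real, ← two_power_aleph0]
    exact mk_le_two_power_aleph0_of_separableSpace _
  let f (L : SepCompactLine κ) : L.carrier ↪ ℝ := (hemb L).some
  -- The code is the order transported to `ℝ`; by reflexivity its diagonal recovers the underlying
  -- set, so equal codes give order isomorphic lines.
  let code : SepCompactLine κ → Set (ℝ × ℝ) := fun L =>
    (fun p : L.carrier × L.carrier => (f L p.1, f L p.2)) '' {p | p.1 ≤ p.2}
  have hcode : ∀ L x y, (f L x, f L y) ∈ code L ↔ x ≤ y := by
    refine fun L x y => ⟨?_, fun h => ⟨(x, y), h, rfl⟩⟩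
    rintro ⟨⟨a, b⟩, hab, h⟩
    simp only [Prod.mk.injEq, EmbeddingLike.apply_eq_iff_eq] at h
    exact h.1 ▸ h.2 ▸ hab
  have hrange : ∀ L z, (z, z) ∈ code L ↔ z ∈ range (f L) := by
    refine fun L z => ⟨?_, ?_⟩
    · rintro ⟨⟨a, b⟩, -, h⟩
      exact ⟨a, congrArg Prod.fst h⟩
    · rintro ⟨a, rfl⟩
      exact (hcode L a a).2 le_rfl
  have hiso : ∀ K L, code K = code L → IsoFunctionSpaces K.carrier L.carrier := by
    intro K L h
    have hr : range (f K) = range (f L) := by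
      ext z
      rw [← hrange, h, hrange]
    let e : K.carrier ≃ L.carrier := (Equiv.ofInjective _ (f K).injective).trans
      ((Equiv.setCongr hr).trans (Equiv.ofInjective _ (f L).injective).symm)
    have he : ∀ x, f L (e x) = f K x := fun x =>
      Equiv.apply_ofInjective_symm (f L).injective _
    refine isoFunctionSpaces_of_orderIso ⟨e, ?_⟩
    intro x y
    rw [← hcode L, ← hcode K, he, he, h]
  have hinj : Function.Injective fun x : IsoTypes κ => ULift.up.{1} (code (Quotient.out x)) := by
    intro x y hxy
    have := hiso _ _ (ULift.up_injective hxy)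
    rw [← Quotient.out_eq x, ← Quotient.out_eq y]
    exact Quotient.sound this
  refine (mk_le_of_injective hinj).trans ?_
  rw [mk_uLift]
  simp [mk_real]

theorem theorem1p2 :
    (∀ κ : Cardinal.{0}, κ ≤ 2 ^ ℵ₀ → (2 : Cardinal.{0}) ^ ℵ₀ < 2 ^ κ →
      ∃ (ι : Type) (L : ι → SepCompactLine κ), #ι = 2 ^ κ ∧
        Pairwise fun i j => ¬ IsoFunctionSpaces (L i).carrier (L j).carrier) ∧
    ((2 : Cardinal.{0}) ^ ℵ₀ = ℵ₁ →
      #(IsoTypes ℵ₁) = Cardinal.lift.{1, 0} (2 ^ (ℵ₁ : Cardinal.{0}))) := by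
  refine ⟨fun κ hκ h => exists_pairwise_not_isoFunctionSpaces hκ h, fun hCH => le_antisymm ?_ ?_⟩
  · have := mk_isoTypes_le ℵ₁
    rwa [hCH] at this
  · obtain ⟨ι, L, hι, hL⟩ := exists_pairwise_not_isoFunctionSpaces hCH.ge (hCH ▸ cantor _)
    rw [← hι, ← mk_uLift]
    refine mk_le_of_injective (f := fun i => (Quotient.mk (isoSetoid ℵ₁) (L i.down))) fun i j hij => ?_
    by_contra hne
    exact hL (fun h => hne (ULift.down_injective h)) (Quotient.exact hij)
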